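/- **Theorem 4.** A time-slotted wireless network consists of a finite set $V$ of at least two nodes, a source $r\in V$, a set $E$ of directed links, integer capacities $c_e\ge 0$ (packets per slot) and an arbitrary non-empty set $\mathcal S\subseteq\{0,1\}^E$ of feasible link-activation vectors. Let $K\ge 1$. Before the first slot, $K$ random permutations $\prec_1,\dots,\prec_K$ of $V$ are drawn, each with $r$ at the first position (their joint law is arbitrary; in particular they may be independent and uniform). Class $k$ consists of the links $E^k=\{(a,b)\in E: a\prec_k b\}$; the resulting DAG is connected if it contains a directed path from $r$ to every node. In slot $t=0,1,2,\dots$, $A(t)\in\mathbb Z_{\ge0}$ packets arrive at $r$; the $A(t)$ are i.i.d. with mean $\lambda$ and finite second moment, and $A(t)$ is independent of everything before slot $t$, including the permutations. *The multiclass algorithm.* Each node $j$ keeps for each class $k$ the number $R^k_j(t)$ of packets of class $k$ that it has received (in order), with $R^k_j(0)=0$. For every class put, with $\mathrm{In}^k(j)=\{i:(i,j)\in E^k\}$, $$Q^k_{ij}=R^k_i-R^k_j,\qquad X^k_j=\min_{i\in \mathrm{In}^k(j)}Q^k_{ij},\qquad K^k_j=\Big\{m: j=\arg\min_{i\in\mathrm{In}^k(m)}Q^k_{im}\Big\},$$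 $$W^k_{ij}=\Big(X^k_j-\sum_{m\in K^k_j}X^k_m\Big)^+\ \text{ for }(i,j)\in E^k,\qquad W_e=\max_{k:\,e\in E^k}W^k_e$$ ($X^k_j=0$ if $\mathrm{In}^k(j)=\emptyset$; $W_e=0$ if $e$ is in no class). Ties are broken arbitrarily, those in the definition of $K^k_j(t)$ without knowledge of $A(t),A(t+1),\dots$. In slot $t$: 1. each packet arriving at $r$ joins a class $l$ that minimizes $\sum_{m\in K^l_r(t)}X^l_m(t)$ among the classes whose DAG is connected (any class, if there is none); 2. an activation vector $s(t)\in\arg\max_{s\in\mathcal S}\sum_e c_e s_e W_e(t)$ is used; 3. every activated link $e$ with $W_e(t)>0$ serves one class $k$ with $e\in E^k$ and $W^k_e(t)=W_e(t)$; links with $W_e(t)=0$ carry nothing; 4. $R^k_r(t+1)$ is $R^k_r(t)$ plus the number of packets that joined class $k$, and for $j\ne r$, $R^k_j(t+1)=R^k_j(t)+\min\{M^k_j(t),X^k_j(t)\}$, where $M^k_j(t)$ is the total capacity of the activated links into $j$ that serve class $k$. Let $$\lambda^K=\max\ \sum_{k=1}^K\ \min_{j\ne r}\ \sum_{i:(i,j)\in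 E}c_{ij}\,\beta^k_{ij},$$ the maximum being over all $\beta^1,\dots,\beta^K\in\mathbb R_{\ge0}^E$ with $\beta^k_e=0$ for $e\notin E^k$ and $\sum_k\beta^k\in\mathrm{conv}(\mathcal S)$ (put $\lambda^K=0$ if there are no such vectors; otherwise the maximum is attained). Then the algorithm supports the broadcast rate $\lambda^K$: almost surely, if $\lambda\le\lambda^K$, then $$\min_{i\in V}\ \liminf_{T\to\infty}\frac1T\sum_{k=1}^K R^k_i(T)=\lambda .$$ -/

import Mathlib

open MeasureTheory ProbabilityTheory Filter

/-- A time-slotted wireless network: source node, directed links, integer link capacities (packets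
per slot), and an arbitrary nonempty set of feasible binary link-activation vectors. -/
structure WirelessNetwork (V : Type*) [Fintype V] [DecidableEq V] where
  /-- the source node -/
  r : V
  /-- the directed links -/
  E : Finset (V × V)
  /-- the number of packets a link can carry in a slot in which it is activated -/
  c : E → ℕ
  /-- the feasible link-activation vectors -/
  S : Set (E → Bool)
  /-- at least one activation vector is feasible -/
  nonempty : S.Nonempty

/-- A permutation of the nodes: `p a < p b` means that `a` appears before `b`. -/
abbrev NodeOrder (V : Type*) [Fintype V] := V ≃ Fin (Fintype.card V)

namespace WirelessNetwork

variable {V : Type*} [Fintype V] [DecidableEq V] (N : WirelessNetwork V) {K : ℕ}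

/-- The source is at the first position of the permutation. -/
def SourceFirst (p : NodeOrder V) : Prop := ∀ v, p N.r ≤ p v

/-- The links of the DAG that the permutation embeds in the network. -/
def classEdges (p : NodeOrder V) : Finset N.E :=
  Finset.univ.filter fun e => p e.1.1 < p e.1.2

/-- The in-neighbours of `j` in the embedded DAG. -/
def inNbrs (p : NodeOrder V) (j : V) : Finset V :=
  Finset.univ.filter fun i => (i, j) ∈ N.E ∧ p i < p j

/-- The embedded DAG is connected: there is a directed path from the source to every node. -/
def Usable (p : NodeOrder V) : Prop :=
  ∀ v, Relation.ReflTransGen (fun a b => a ∈ N.inNbrs p b) N.r v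

/-- The packet deficit `Q_ij = R_i - R_j`; the packets of a class are received in order, so a node
with counter `n` has received exactly the packets `1, ..., n` of the class. -/
def deficit (R : V → ℕ) (i j : V) : ℤ := (R i : ℤ) - (R j : ℤ)

/-- The minimum packet deficit `X_j` (zero by convention if `j` has no in-neighbour). -/
def minDeficit (p : NodeOrder V) (R : V → ℕ) (j : V) : ℤ :=
  if h : (N.inNbrs p j).Nonempty then (N.inNbrs p j).inf' h (fun i => deficit R i j) else 0

/-- `par` selects, for each node that has in-neighbours, one that minimizes the deficit. -/
def IsMinimizer (p : NodeOrder V) (R : V → ℕ) (par : V → V) : Prop :=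
  ∀ j, (N.inNbrs p j).Nonempty →
    par j ∈ N.inNbrs p j ∧ ∀ i ∈ N.inNbrs p j, deficit R (par j) j ≤ deficit R i j

/-- The set `K_j` of the out-neighbours of `j` whose selected deficit minimizer is `j`. -/
def children (p : NodeOrder V) (par : V → V) (j : V) : Finset V :=
  Finset.univ.filter fun m => j ∈ N.inNbrs p m ∧ par m = j

/-- `∑_{m ∈ K_j} X_m`; at `j = r` this is the quantity that decides the admission to a class. -/
def childSum (p : NodeOrder V) (R : V → ℕ) (par : V → V) (j : V) : ℤ :=
  ∑ m ∈ N.children p par j, N.minDeficit p R m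

/-- The weight `W_ij = (X_j - ∑_{m ∈ K_j} X_m)⁺` of a link of the class, zero on other links. -/
def classWeight (p : NodeOrder V) (R : V → ℕ) (par : V → V) (e : N.E) : ℕ :=
  if e ∈ N.classEdges p then (N.minDeficit p R e.1.2 - N.childSum p R par e.1.2).toNat else 0

/-- The overall weight of a link: the maximum of its weights over the classes containing it. -/
def linkWeight (p : Fin K → NodeOrder V) (R : Fin K → V → ℕ) (par : Fin K → V → V)
    (e : N.E) : ℕ :=
  Finset.univ.sup fun k => N.classWeight (p k) (R k) (par k) e

/-- A class that may receive the new packets: one of smallest `∑_{m ∈ K_r} X_m` among the classes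
whose DAG is connected. -/
def Admissible (p : Fin K → NodeOrder V) (R : Fin K → V → ℕ) (par : Fin K → V → V)
    (l : Fin K) : Prop :=
  (∃ m, N.Usable (p m)) → N.Usable (p l) ∧
    ∀ m, N.Usable (p m) →
      N.childSum (p l) (R l) (par l) N.r ≤ N.childSum (p m) (R m) (par m) N.r

/-- `∑_e c_e s_e W_e` -/
def activationWeight (W : N.E → ℕ) (s : N.E → Bool) : ℕ :=
  ∑ e, N.c e * (if s e then 1 else 0) * W e

/-- The total capacity that class `k` gets on the links into `j`, if the activated links `e` of
positive weight serve the classes `κ e`; a link of weight zero carries nothing. -/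
def service (W : N.E → ℕ) (s : N.E → Bool) (κ : N.E → Fin K) (k : Fin K) (j : V) : ℕ :=
  ∑ e ∈ Finset.univ.filter (fun e : N.E => e.1.2 = j ∧ s e = true ∧ 0 < W e ∧ κ e = k), N.c e

/-- One slot of the multiclass algorithm, from the counters `R` to the counters `R'`, with `A` new
packets at the source. All ties are broken arbitrarily. -/
def Slot (p : Fin K → NodeOrder V) (R : Fin K → V → ℕ) (par : Fin K → V → V) (A : ℕ)
    (R' : Fin K → V → ℕ) : Prop :=
  (∀ k, N.IsMinimizer (p k) (R k) (par k)) ∧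
  ∃ (a : Fin K → ℕ) (s : N.E → Bool) (κ : N.E → Fin K),
    (∑ k, a k = A) ∧
    (∀ k, a k ≠ 0 → N.Admissible p R par k) ∧
    s ∈ N.S ∧
    (∀ s' ∈ N.S, N.activationWeight (N.linkWeight p R par) s' ≤
      N.activationWeight (N.linkWeight p R par) s) ∧
    (∀ e, s e = true → 0 < N.linkWeight p R par e →
      e ∈ N.classEdges (p (κ e)) ∧
      N.classWeight (p (κ e)) (R (κ e)) (par (κ e)) e = N.linkWeight p R par e) ∧
    ∀ k j, R' k j =
      if j = N.r then R k j + a k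
      else R k j + min (N.service (N.linkWeight p R par) s κ k j) (N.minDeficit (p k) (R k) j).toNat

/-- The feasible activation vectors, as real vectors. -/
def activationVectors : Set (N.E → ℝ) :=
  (fun (s : N.E → Bool) (e : N.E) => if s e then (1 : ℝ) else 0) '' N.S

/-- `β^1, ..., β^K` are nonnegative, `β^k` is supported on the links of class `k`, and their sum is
in the convex hull of the activation vectors. -/
def Feasible (p : Fin K → NodeOrder V) (β : Fin K → N.E → ℝ) : Prop :=
  (∀ k e, 0 ≤ β k e) ∧ (∀ k, ∀ e ∉ N.classEdges (p k), β k e = 0) ∧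
    (∑ k, β k) ∈ convexHull ℝ N.activationVectors

/-- `∑_k min_{j ≠ r} ∑_i c_ij β^k_ij` -/
noncomputable def totalRate (β : Fin K → N.E → ℝ) : ℝ :=
  ∑ k, ⨅ j : {j : V // j ≠ N.r},
    ∑ e ∈ Finset.univ.filter (fun e : N.E => e.1.2 = j.1), (N.c e : ℝ) * β k e

/-- The values over which the rate of the `K` classes is the maximum. -/
def rateValues (p : Fin K → NodeOrder V) : Set ℝ :=
  {v | ∃ β : Fin K → N.E → ℝ, N.Feasible p β ∧ v = N.totalRate β}

/-- The rate `λ^K` of the `K` classes. -/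
noncomputable def multiclassRate (p : Fin K → NodeOrder V) : ℝ := sSup (N.rateValues p)

end WirelessNetwork

/-- The arrivals: i.i.d. over the slots, with mean `lam` and finite second moment, those of slot `t`
being independent of the past `ℱ t`. -/
structure IsArrivalProcess {Ω : Type*} [mΩ : MeasurableSpace Ω] (μ : Measure Ω)
    (ℱ : Filtration ℕ mΩ) (A : ℕ → Ω → ℕ) (lam : ℝ) : Prop where
  measurable : ∀ t, Measurable (A t)
  indep : iIndepFun A μ
  identDistrib : ∀ t, IdentDistrib (A t) (A 0) μ μ
  memLp : MemLp (fun ω => (A 0 ω : ℝ)) 2 μ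
  mean : ∫ ω, (A 0 ω : ℝ) ∂μ = lam
  indep_past : ∀ t, Indep (MeasurableSpace.comap (A t) inferInstance) (ℱ t) μ

/-- The multiclass algorithm, run from time zero with the random permutations `σ` (of any joint law,
drawn before the first slot); `R ω t k j` is the number of packets of class `k` that node `j` has
received before slot `t`, and `par ω t k` the choice of the deficit minimizers in slot `t`. -/
structure IsMulticlassRun {V : Type*} [Fintype V] [DecidableEq V] (N : WirelessNetwork V) {K : ℕ}
    {Ω : Type*} [mΩ : MeasurableSpace Ω] (ℱ : Filtration ℕ mΩ) (A : ℕ → Ω → ℕ)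
    (σ : Ω → Fin K → NodeOrder V) (R : Ω → ℕ → Fin K → V → ℕ)
    (par : Ω → ℕ → Fin K → V → V) : Prop where
  sourceFirst : ∀ ω k, N.SourceFirst (σ ω k)
  order_measurable : ∀ k v, Measurable[ℱ 0] fun ω => σ ω k v
  counter_measurable : ∀ t k v, Measurable[ℱ t] fun ω => R ω t k v
  par_measurable : ∀ t k v i, MeasurableSet[ℱ t] {ω | par ω t k v = i}
  init : ∀ ω k v, R ω 0 k v = 0
  slot : ∀ ω t, N.Slot (σ ω) (R ω t) (par ω t) (A t ω) (R ω (t + 1))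

/-- `min_i liminf_{T → ∞} R_i(T) / T`, where `R_i(T)` counts the distinct packets, of all classes,
that node `i` has received. -/
noncomputable def broadcastRate {V : Type*} {K : ℕ} (R : ℕ → Fin K → V → ℕ) : EReal :=
  ⨅ i : V, liminf (fun T : ℕ => (((∑ k, R T k i : ℕ) : ℝ) / (T : ℝ) : ℝ).toEReal) atTop

/-!
The set of feasible families is compact and the total rate is continuous, so the maximum that
defines the rate of the classes is attained. The broadcast claim is a quadratic Lyapunov argument
for the minimum deficits `X_j` of all classes, which covers the boundary `lam = λ^K` because it uses
no negative drift.

*Queueing recursion.* Comparing the deficit at `j` with its selected minimizer `i` gives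
`X_j' ≤ (X_j - M_j)⁺ + M_i`, where the service `M_r` of the source stands for the arrivals
(`ClassStep.minDeficit_le_max_add`). Summing the squares and regrouping by the selected minimizers,
the drift of `L = ∑_k ∑_j X_j²` is at most a constant times `(C + A)²`, `C` the total capacity,
plus twice the difference between `∑_k a_k ∑_{m ∈ K_r} X_m` and
`∑_k ∑_j M_j (X_j - ∑_{m ∈ K_j} X_m)` (`ClassStep.sum_sq_le`).

*Control.* The second sum is the weight of the activation (`sum_service_mul`), so by the max-weight
rule it is at least `∑_k ρ_k ∑_{m ∈ K_r} X_m` for a family of class rates `ρ_k` with sum `λ^K`,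
because `∑_{j ≠ r} (X_j - ∑_{m ∈ K_j} X_m)` telescopes to `∑_{m ∈ K_r} X_m`. All arrivals join
connected classes with the smallest value `m` of `∑_{m ∈ K_r} X_m`, and disconnected classes have
`ρ_k = 0`. Hence `L(t+1) - L(t) ≤ const (C + A(t))² + 2 (A(t) - lam) m(t)` wherever `lam ≤ λ^K`
(`Slot.lyapunov_le`).

*Probability.* As `m(t)` is known before `A(t)` and the event `lam ≤ λ^K` before the first slot, the
last term has mean zero, so the mean of `L` on the event grows at most linearly. Along the squares
`L(n²) / n⁴` then has summable means and tends to zero almost surely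
(`IsMulticlassRun.ae_tendsto_lyapunov`). Since every node lags behind the source by at most a
multiple of `√L`, its counters grow at the rate `lam` along the squares, and along all times by
monotonicity (`IsTrajectory.tendsto_div`).
-/

/-! ### The drift of one class -/

namespace WirelessNetwork

variable {V : Type*} [Fintype V] [DecidableEq V] (N : WirelessNetwork V) {K : ℕ}

/-- No node is ahead of its in-neighbours in the DAG. -/
def Ordered (p : NodeOrder V) (R : V → ℕ) : Prop :=
  ∀ j, ∀ i ∈ N.inNbrs p j, R j ≤ R i

variable {N}

theorem lt_of_mem_inNbrs {p : NodeOrder V} {i j : V} (h : i ∈ N.inNbrs p j) : p i < p j :=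
  (Finset.mem_filter.1 h).2.2

theorem SourceFirst.inNbrs_source {p : NodeOrder V} (hp : N.SourceFirst p) :
    N.inNbrs p N.r = ∅ :=
  Finset.eq_empty_of_forall_notMem fun i hi => (hp i).not_gt (lt_of_mem_inNbrs hi)

theorem minDeficit_eq_zero {p : NodeOrder V} {R : V → ℕ} {j : V}
    (h : ¬ (N.inNbrs p j).Nonempty) : N.minDeficit p R j = 0 := by
  simp [minDeficit, h]

theorem minDeficit_le {p : NodeOrder V} {R : V → ℕ} {i j : V} (h : i ∈ N.inNbrs p j) :
    N.minDeficit p R j ≤ deficit R i j := by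
  rw [minDeficit, dif_pos ⟨i, h⟩]
  exact Finset.inf'_le _ h

theorem Ordered.minDeficit_nonneg {p : NodeOrder V} {R : V → ℕ} (hR : N.Ordered p R) (j : V) :
    0 ≤ N.minDeficit p R j := by
  unfold minDeficit
  split_ifs with h
  · refine Finset.le_inf' _ _ fun i hi => ?_
    have := hR j i hi
    unfold deficit
    omega
  · exact le_rfl

theorem IsMinimizer.minDeficit_eq {p : NodeOrder V} {R : V → ℕ} {par : V → V}
    (h : N.IsMinimizer p R par) {j : V} (hj : (N.inNbrs p j).Nonempty) :
    N.minDeficit p R j = deficit R (par j) j := by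
  refine le_antisymm (minDeficit_le (h j hj).1) ?_
  rw [minDeficit, dif_pos hj]
  exact Finset.le_inf' _ _ (h j hj).2

theorem SourceFirst.minDeficit_source {p : NodeOrder V} (hp : N.SourceFirst p) (R : V → ℕ) :
    N.minDeficit p R N.r = 0 :=
  minDeficit_eq_zero (by simp [hp.inNbrs_source])

theorem Ordered.childSum_nonneg {p : NodeOrder V} {R : V → ℕ} (hR : N.Ordered p R)
    (par : V → V) (j : V) : 0 ≤ N.childSum p R par j :=
  Finset.sum_nonneg fun m _ => hR.minDeficit_nonneg m

/-- Summation by parts on the forest of the selected minimizers: each node is a child of exactly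
one node, unless its minimum deficit is zero by convention. -/
theorem IsMinimizer.sum_mul_childSum {p : NodeOrder V} {R : V → ℕ} {par : V → V}
    (h : N.IsMinimizer p R par) (f : V → ℝ) :
    ∑ j, f j * (N.childSum p R par j : ℝ) = ∑ m, f (par m) * (N.minDeficit p R m : ℝ) := by
  have key : ∀ j, f j * (N.childSum p R par j : ℝ) =
      ∑ m, if par m = j then f j * (N.minDeficit p R m : ℝ) else 0 := by
    intro j
    rw [childSum, children, Int.cast_sum, Finset.mul_sum, Finset.sum_filter]
    refine Finset.sum_congr rfl fun m _ => ?_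
    by_cases hm : (N.inNbrs p m).Nonempty
    · by_cases hj : par m = j
      · subst hj
        simp [(h m hm).1]
      · simp [hj]
    · simp [minDeficit_eq_zero hm]
  simp_rw [key]
  rw [Finset.sum_comm]
  refine Finset.sum_congr rfl fun m _ => ?_
  rw [Finset.sum_ite_eq]
  simp

/-- The minimum deficits telescope along the forest, up to the deficits of the children of the
source. -/
theorem IsMinimizer.sum_sub_childSum {p : NodeOrder V} {R : V → ℕ} {par : V → V}
    (hp : N.SourceFirst p) (h : N.IsMinimizer p R par) :
    ∑ j ∈ Finset.univ.erase N.r, ((N.minDeficit p R j : ℝ) - N.childSum p R par j) =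
      N.childSum p R par N.r := by
  have h1 := h.sum_mul_childSum (fun _ => 1)
  have h2 := Finset.add_sum_erase Finset.univ
    (fun j => (N.minDeficit p R j : ℝ) - N.childSum p R par j) (Finset.mem_univ N.r)
  simp only [one_mul] at h1
  have h3 : ∑ j, ((N.minDeficit p R j : ℝ) - N.childSum p R par j) = 0 := by
    rw [Finset.sum_sub_distrib, h1, sub_self]
  rw [h3, hp.minDeficit_source, Int.cast_zero] at h2
  linarith

/-- The growth of the square of a queue length `x` with service `m` and input `n`. -/
theorem sq_le_of_le_max_add {x x' m n : ℝ} (hx : 0 ≤ x) (hx' : 0 ≤ x') (hm : 0 ≤ m) (hn : 0 ≤ n)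
    (h : x' ≤ max (x - m) 0 + n) :
    x' ^ 2 ≤ x ^ 2 + (m ^ 2 + n ^ 2) - 2 * (x * m - x * n) := by
  rcases max_cases (x - m) 0 with ⟨h1, h2⟩ | ⟨h1, h2⟩ <;> rw [h1] at h
  · nlinarith [mul_nonneg hm hn]
  · nlinarith [sq_nonneg (x - m), mul_nonneg hx hn]

/-- The part of a slot that concerns one class: `a` packets join the class, and a node other than
the source receives the `M j` packets its links can carry, as far as all in-neighbours have them. -/
def ClassStep (N : WirelessNetwork V) (p : NodeOrder V) (R : V → ℕ) (a : ℕ) (M : V → ℕ)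
    (R' : V → ℕ) : Prop :=
  ∀ j, R' j = if j = N.r then R j + a else R j + min (M j) (N.minDeficit p R j).toNat

section ClassStep

variable {p : NodeOrder V} {R R' : V → ℕ} {a : ℕ} {M : V → ℕ}

theorem ClassStep.le (h : N.ClassStep p R a M R') (j : V) : R j ≤ R' j := by
  rw [h j]; split_ifs <;> omega

theorem ClassStep.le_of_mem_inNbrs (h : N.ClassStep p R a M R') (hp : N.SourceFirst p)
    (hR : N.Ordered p R) {i j : V} (hi : i ∈ N.inNbrs p j) : R' j ≤ R i := by
  have hj : j ≠ N.r := by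
    rintro rfl
    simp [hp.inNbrs_source] at hi
  have h1 := minDeficit_le (R := R) hi
  have h2 := hR j i hi
  rw [h j, if_neg hj]
  unfold deficit at h1
  omega

theorem ClassStep.ordered (h : N.ClassStep p R a M R') (hp : N.SourceFirst p)
    (hR : N.Ordered p R) : N.Ordered p R' := fun _ i hi =>
  (h.le_of_mem_inNbrs hp hR hi).trans (h.le i)

theorem ClassStep.le_source (h : N.ClassStep p R a M R') (hp : N.SourceFirst p)
    (hR : N.Ordered p R) (hle : ∀ j, R j ≤ R N.r) (j : V) : R' j ≤ R' N.r := by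
  by_cases hn : (N.inNbrs p j).Nonempty
  · obtain ⟨i, hi⟩ := hn
    exact (h.le_of_mem_inNbrs hp hR hi).trans ((hle i).trans (h.le _))
  · by_cases hj : j = N.r
    · rw [hj]
    · have h0 : R' j = R j := by
        rw [h j, if_neg hj, minDeficit_eq_zero hn]; simp
      exact h0 ▸ (hle j).trans (h.le _)

/-- The queueing recursion `X_j' ≤ (X_j - M_j)⁺ + M_{par j}`: the minimum deficit of a node is
served by the links into the node and fed by the service of the selected minimizer (by the
arrivals, if that is the source). -/
theorem ClassStep.minDeficit_le_max_add (h : N.ClassStep p R a M R') (hp : N.SourceFirst p)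
    (hR : N.Ordered p R) {par : V → V} (hpar : N.IsMinimizer p R par) (j : V) :
    (N.minDeficit p R' j : ℝ) ≤
      max (N.minDeficit p R j - (M j : ℝ)) 0 + (M (par j) + if par j = N.r then a else 0 : ℕ) := by
  by_cases hn : (N.inNbrs p j).Nonempty
  · have hmem := (hpar j hn).1
    have hj : j ≠ N.r := by
      rintro rfl
      simp [hp.inNbrs_source] at hmem
    have h1 : N.minDeficit p R' j ≤ _ := minDeficit_le hmem
    have h2 := hpar.minDeficit_eq hn
    have h0 := hR.minDeficit_nonneg j
    have h3 := h j
    have h4 := h (par j)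
    rw [if_neg hj] at h3
    have h5 : R' (par j) ≤ R (par j) + (M (par j) + if par j = N.r then a else 0) := by
      rw [h4]; split_ifs <;> omega
    unfold deficit at h1 h2
    have h6 : N.minDeficit p R' j ≤ max (N.minDeficit p R j - (M j : ℤ)) 0 +
        (M (par j) + if par j = N.r then a else 0 : ℕ) := by
      omega
    exact_mod_cast h6
  · rw [minDeficit_eq_zero hn, Int.cast_zero]
    exact add_nonneg (le_max_right _ _) (Nat.cast_nonneg _)

/-- The drift of the sum of the squared minimum deficits of one class. -/
theorem ClassStep.sum_sq_le (h : N.ClassStep p R a M R') (hp : N.SourceFirst p)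
    (hR : N.Ordered p R) {par : V → V} (hpar : N.IsMinimizer p R par)
    {B : ℝ} (hB : ∀ j, (M j : ℝ) + a ≤ B) :
    ∑ j, (N.minDeficit p R' j : ℝ) ^ 2 ≤ ∑ j, (N.minDeficit p R j : ℝ) ^ 2 +
      2 * Fintype.card V * B ^ 2 + 2 * (a * N.childSum p R par N.r) -
      2 * ∑ j, (M j : ℝ) * ((N.minDeficit p R j : ℝ) - N.childSum p R par j) := by
  -- the service received by a node, where the source is served by the arrivals
  set m : V → ℝ := fun j => M j + if j = N.r then (a : ℝ) else 0 with hm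
  have hm0 : ∀ j, 0 ≤ m j := fun j => by simp only [hm]; positivity
  have hmB : ∀ j, m j ^ 2 ≤ B ^ 2 := fun j => by
    refine pow_le_pow_left₀ (hm0 j) (le_trans ?_ (hB j)) 2
    simp only [hm]
    split_ifs <;> simp
  have hX : ∀ j, 0 ≤ (N.minDeficit p R j : ℝ) := fun j => by
    exact_mod_cast hR.minDeficit_nonneg j
  have step : ∀ j, (N.minDeficit p R' j : ℝ) ^ 2 ≤ (N.minDeficit p R j : ℝ) ^ 2 +
      (B ^ 2 + B ^ 2) - 2 * (m j * N.minDeficit p R j - m (par j) * N.minDeficit p R j) := by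
    intro j
    have h1 := h.minDeficit_le_max_add hp hR hpar j
    have h2 : ((M (par j) + if par j = N.r then a else 0 : ℕ) : ℝ) = m (par j) := by
      simp only [hm]; push_cast; rfl
    rw [h2] at h1
    have hX' : 0 ≤ (N.minDeficit p R' j : ℝ) := by
      exact_mod_cast (h.ordered hp hR).minDeficit_nonneg j
    have h3 := sq_le_of_le_max_add (hX j) hX' (Nat.cast_nonneg (M j)) (hm0 (par j)) h1
    have h4 : (M j : ℝ) * N.minDeficit p R j = m j * N.minDeficit p R j := by
      by_cases hj : j = N.r
      · simp [hj, hp.minDeficit_source]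
      · simp [hm, hj]
    have h5 : (M j : ℝ) ^ 2 ≤ m j ^ 2 :=
      pow_le_pow_left₀ (Nat.cast_nonneg _) (by simp only [hm]; split_ifs <;> simp) 2
    nlinarith [hmB j, hmB (par j)]
  have hsum := Finset.sum_le_sum fun j (_ : j ∈ Finset.univ) => step j
  rw [Finset.sum_sub_distrib, Finset.sum_add_distrib, ← Finset.mul_sum, Finset.sum_sub_distrib,
    ← hpar.sum_mul_childSum, Finset.sum_const, Finset.card_univ, nsmul_eq_mul] at hsum
  have e1 : ∑ j, m j * (N.minDeficit p R j : ℝ) - ∑ j, m j * (N.childSum p R par j : ℝ) =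
      ∑ j, (M j : ℝ) * ((N.minDeficit p R j : ℝ) - N.childSum p R par j) -
        a * N.childSum p R par N.r := by
    rw [← Finset.sum_sub_distrib]
    have : ∀ j, m j * (N.minDeficit p R j : ℝ) - m j * (N.childSum p R par j : ℝ) =
        (M j : ℝ) * ((N.minDeficit p R j : ℝ) - N.childSum p R par j) +
        if j = N.r then (a : ℝ) * ((N.minDeficit p R j : ℝ) - N.childSum p R par j) else 0 := by
      intro j
      simp only [hm]
      split_ifs <;> ring
    simp_rw [this]
    rw [Finset.sum_add_distrib, Finset.sum_ite_eq', if_pos (Finset.mem_univ _),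
      hp.minDeficit_source]
    push_cast
    ring
  rw [e1] at hsum
  linarith

end ClassStep

/-- In a connected DAG every node other than the source has an in-neighbour. -/
theorem Usable.inNbrs_nonempty {p : NodeOrder V} (h : N.Usable p) {j : V} (hj : j ≠ N.r) :
    (N.inNbrs p j).Nonempty := by
  rcases (Relation.ReflTransGen.cases_tail_iff _ _ _).1 (h j) with h0 | ⟨i, -, hi⟩
  · exact absurd h0 hj
  · exact ⟨i, hi⟩

/-- Acyclicity gives the converse: a DAG in which every node other than the source has an
in-neighbour is connected. -/
theorem usable_of_inNbrs_nonempty {p : NodeOrder V}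
    (h : ∀ j, j ≠ N.r → (N.inNbrs p j).Nonempty) : N.Usable p := by
  intro v
  induction hn : (p v : ℕ) using Nat.strong_induction_on generalizing v with
  | _ n ih =>
    by_cases hv : v = N.r
    · rw [hv]
    · obtain ⟨i, hi⟩ := h v hv
      exact (ih (p i) (hn ▸ lt_of_mem_inNbrs hi) i rfl).tail hi

/-- The deficit from the source is the sum of the minimum deficits along the path of the selected
minimizers, which has fewer than `Fintype.card V` links as the positions decrease. -/
theorem Usable.deficit_source_le {p : NodeOrder V} {R : V → ℕ} {par : V → V} (h : N.Usable p)
    (hpar : N.IsMinimizer p R par) {B : ℝ} (hB : ∀ j, (N.minDeficit p R j : ℝ) ≤ B) (hB0 : 0 ≤ B)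
    (j : V) : (R N.r : ℝ) - R j ≤ Fintype.card V * B := by
  have key : (R N.r : ℝ) - R j ≤ (p j : ℕ) * B := by
    induction hn : (p j : ℕ) using Nat.strong_induction_on generalizing j with
    | _ n ih =>
      by_cases hj : j = N.r
      · rw [hj, sub_self]; positivity
      · have hne := h.inNbrs_nonempty hj
        have hlt : (p (par j) : ℕ) < p j := lt_of_mem_inNbrs (hpar j hne).1
        have h1 := ih (p (par j)) (hn ▸ hlt) (par j) rfl
        have h2 := hB j
        rw [hpar.minDeficit_eq hne, deficit] at h2
        push_cast at h2
        have h3 : ((p (par j) : ℕ) : ℝ) + 1 ≤ n := by exact_mod_cast hn ▸ hlt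
        nlinarith
  refine key.trans (mul_le_mul_of_nonneg_right ?_ hB0)
  exact_mod_cast (p j).2.le

end WirelessNetwork

/-! ### The rate of the classes and the max-weight rule -/

namespace WirelessNetwork

variable {V : Type*} [Fintype V] [DecidableEq V] {N : WirelessNetwork V} {K : ℕ}

/-- The smallest inflow `∑_i c_ij b_ij` over the nodes `j ≠ r`: the broadcast rate of one class. -/
noncomputable def classRate (N : WirelessNetwork V) (b : N.E → ℝ) : ℝ :=
  ⨅ j : {j : V // j ≠ N.r},
    ∑ e ∈ Finset.univ.filter (fun e : N.E => e.1.2 = j.1), (N.c e : ℝ) * b e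

theorem totalRate_eq_sum_classRate (β : Fin K → N.E → ℝ) :
    N.totalRate β = ∑ k, N.classRate (β k) := rfl

theorem classRate_le (b : N.E → ℝ) {j : V} (hj : j ≠ N.r) :
    N.classRate b ≤
      ∑ e ∈ Finset.univ.filter (fun e : N.E => e.1.2 = j), (N.c e : ℝ) * b e :=
  ciInf_le (f := fun j : {j : V // j ≠ N.r} =>
    ∑ e ∈ Finset.univ.filter (fun e : N.E => e.1.2 = j.1), (N.c e : ℝ) * b e)
    (Set.finite_range _).bddBelow ⟨j, hj⟩

theorem classRate_nonneg {b : N.E → ℝ} (hb : ∀ e, 0 ≤ b e) : 0 ≤ N.classRate b :=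
  Real.iInf_nonneg fun _ => Finset.sum_nonneg fun e _ => mul_nonneg (Nat.cast_nonneg _) (hb e)

/-- A class with a disconnected DAG does not contribute to the total rate: some node other than the
source has no in-neighbour. -/
theorem classRate_eq_zero {p : NodeOrder V} {b : N.E → ℝ} (hb : ∀ e, 0 ≤ b e)
    (hsupp : ∀ e ∉ N.classEdges p, b e = 0) (hp : ¬ N.Usable p) : N.classRate b = 0 := by
  refine le_antisymm ?_ (classRate_nonneg hb)
  obtain ⟨j, hj, hne⟩ : ∃ j, j ≠ N.r ∧ ¬ (N.inNbrs p j).Nonempty := by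
    by_contra! h
    exact hp (usable_of_inNbrs_nonempty fun j hj => h j hj)
  refine (classRate_le b hj).trans (Finset.sum_eq_zero fun e he => ?_).le
  rw [hsupp e fun hmem => hne ⟨e.1.1, ?_⟩, mul_zero]
  have h1 := (Finset.mem_filter.1 he).2
  have h2 := (Finset.mem_filter.1 hmem).2
  subst h1
  exact Finset.mem_filter.2 ⟨Finset.mem_univ _, e.2, h2⟩

theorem convexHull_activationVectors_subset :
    convexHull ℝ N.activationVectors ⊆ Set.Icc 0 1 := by
  refine convexHull_min ?_ (convex_Icc 0 1)
  rintro _ ⟨s, -, rfl⟩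
  constructor <;> intro e <;> dsimp only [Pi.zero_apply, Pi.one_apply] <;> split_ifs <;> norm_num

theorem isCompact_setOf_feasible (p : Fin K → NodeOrder V) :
    IsCompact {β | N.Feasible p β} := by
  have hsub : {β | N.Feasible p β} ⊆ Set.Icc (0 : Fin K → N.E → ℝ) 1 := by
    rintro β ⟨h0, -, hconv⟩
    refine ⟨fun k e => h0 k e, fun k e => ?_⟩
    have h1 := (convexHull_activationVectors_subset hconv).2 e
    rw [Finset.sum_apply] at h1
    exact (Finset.single_le_sum (f := fun k => β k e) (fun k _ => h0 k e)
      (Finset.mem_univ k)).trans h1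
  refine isCompact_Icc.of_isClosed_subset ?_ hsub
  have hfin : N.activationVectors.Finite := (Set.toFinite N.S).image _
  have e1 : {β | N.Feasible p β} = (⋂ k, ⋂ e, {β | 0 ≤ β k e}) ∩
      ((⋂ k, ⋂ e, ⋂ (_ : e ∉ N.classEdges (p k)), {β | β k e = 0}) ∩
        (fun β : Fin K → N.E → ℝ => ∑ k, β k) ⁻¹' convexHull ℝ N.activationVectors) := by
    ext β
    simp [Feasible]
  rw [e1]
  refine IsClosed.inter (isClosed_iInter fun k => isClosed_iInter fun e =>
    isClosed_le continuous_const (by fun_prop)) (IsClosed.inter (isClosed_iInter fun k =>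
    isClosed_iInter fun e => isClosed_iInter fun _ =>
    isClosed_eq (by fun_prop) continuous_const) ?_)
  exact (hfin.isCompact_convexHull (𝕜 := ℝ)).isClosed.preimage (by fun_prop)

section Attained

variable [Nontrivial V]

theorem continuous_totalRate : Continuous (N.totalRate : (Fin K → N.E → ℝ) → ℝ) := by
  obtain ⟨v, hv⟩ := exists_ne N.r
  have : Nonempty {j : V // j ≠ N.r} := ⟨⟨v, hv⟩⟩
  refine continuous_finsetSum _ fun k _ => ?_
  simp_rw [← Finset.inf'_univ_eq_ciInf]
  refine Continuous.finset_inf'_apply _ fun j _ => continuous_finsetSum _ fun e _ => ?_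
  fun_prop

theorem isGreatest_multiclassRate {p : Fin K → NodeOrder V} (hne : (N.rateValues p).Nonempty) :
    IsGreatest (N.rateValues p) (N.multiclassRate p) := by
  have e1 : N.rateValues p = N.totalRate '' {β | N.Feasible p β} := by
    ext v
    simp [rateValues, eq_comm]
  have hcomp : IsCompact (N.rateValues p) :=
    e1 ▸ (isCompact_setOf_feasible p).image continuous_totalRate
  exact hcomp.isGreatest_sSup hne

end Attained

/-- A positive rate of the classes is attained by a feasible family. -/
theorem exists_feasible_of_multiclassRate_pos [Nontrivial V] {p : Fin K → NodeOrder V}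
    (h : 0 < N.multiclassRate p) :
    ∃ β : Fin K → N.E → ℝ, N.Feasible p β ∧ N.totalRate β = N.multiclassRate p := by
  have hne : (N.rateValues p).Nonempty := by
    by_contra hne
    rw [Set.not_nonempty_iff_eq_empty] at hne
    simp [multiclassRate, hne] at h
  obtain ⟨β, hβ, hv⟩ := (isGreatest_multiclassRate hne).1
  exact ⟨β, hβ, hv.symm⟩

/-- Max-weight: the activation vector used is at least as good as any point of the convex hull. -/
theorem sum_le_activationWeight {W : N.E → ℕ} {s : N.E → Bool}
    (hs : ∀ s' ∈ N.S, N.activationWeight W s' ≤ N.activationWeight W s) {x : N.E → ℝ}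
    (hx : x ∈ convexHull ℝ N.activationVectors) :
    ∑ e, (N.c e : ℝ) * x e * W e ≤ N.activationWeight W s := by
  let f : (N.E → ℝ) →ₗ[ℝ] ℝ :=
    { toFun := fun x => ∑ e, (N.c e : ℝ) * x e * W e
      map_add' := fun x y => by
        rw [← Finset.sum_add_distrib]
        exact Finset.sum_congr rfl fun e _ => by simp only [Pi.add_apply]; ring
      map_smul' := fun c x => by
        rw [RingHom.id_apply, smul_eq_mul, Finset.mul_sum]
        exact Finset.sum_congr rfl fun e _ => by simp only [Pi.smul_apply, smul_eq_mul]; ring }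
  have hsub : convexHull ℝ N.activationVectors ⊆ {x | f x ≤ N.activationWeight W s} := by
    refine convexHull_min ?_ (convex_halfSpace_le f.isLinear _)
    rintro _ ⟨s', hs', rfl⟩
    have h1 : ((N.activationWeight W s' : ℕ) : ℝ) ≤ N.activationWeight W s := by
      exact_mod_cast hs s' hs'
    refine le_trans (le_of_eq ?_) h1
    simp [f, activationWeight]
  exact hsub hx

theorem classWeight_le_linkWeight (p : Fin K → NodeOrder V) (R : Fin K → V → ℕ)
    (par : Fin K → V → V) (k : Fin K) (e : N.E) :
    N.classWeight (p k) (R k) (par k) e ≤ N.linkWeight p R par e :=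
  Finset.le_sup (f := fun k => N.classWeight (p k) (R k) (par k) e) (Finset.mem_univ k)

/-- The rate of one class, times the deficits at the source, is at most the weight that the class
gives to its share of the activations. -/
theorem classRate_mul_childSum_le {p : NodeOrder V} (hp : N.SourceFirst p) {R : V → ℕ}
    {par : V → V} (hpar : N.IsMinimizer p R par) {b : N.E → ℝ} (hb : ∀ e, 0 ≤ b e)
    (hsupp : ∀ e ∉ N.classEdges p, b e = 0) :
    N.classRate b * N.childSum p R par N.r ≤
      ∑ e, (N.c e : ℝ) * b e * N.classWeight p R par e := by
  set w : V → ℝ := fun j => ((N.minDeficit p R j - N.childSum p R par j).toNat : ℝ) with hw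
  have hw' : ∀ j, (N.minDeficit p R j : ℝ) - N.childSum p R par j ≤ w j := fun j => by
    simp only [hw]
    exact_mod_cast Int.self_le_toNat _
  have hr := classRate_nonneg hb
  calc N.classRate b * N.childSum p R par N.r
      = ∑ j ∈ Finset.univ.erase N.r,
          N.classRate b * ((N.minDeficit p R j : ℝ) - N.childSum p R par j) := by
        rw [← Finset.mul_sum, hpar.sum_sub_childSum hp]
    _ ≤ ∑ j ∈ Finset.univ.erase N.r,
          (∑ e ∈ Finset.univ.filter (fun e : N.E => e.1.2 = j), (N.c e : ℝ) * b e) * w j := by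
        refine Finset.sum_le_sum fun j hj => ?_
        exact (mul_le_mul_of_nonneg_left (hw' j) hr).trans (mul_le_mul_of_nonneg_right
          (classRate_le b (Finset.ne_of_mem_erase hj)) (Nat.cast_nonneg _))
    _ ≤ ∑ j, (∑ e ∈ Finset.univ.filter (fun e : N.E => e.1.2 = j), (N.c e : ℝ) * b e) * w j := by
        refine Finset.sum_le_sum_of_subset_of_nonneg (Finset.erase_subset _ _) fun j _ _ => ?_
        exact mul_nonneg (Finset.sum_nonneg fun e _ => mul_nonneg (Nat.cast_nonneg _) (hb e))
          (Nat.cast_nonneg _)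
    _ = ∑ j, ∑ e ∈ Finset.univ.filter (fun e : N.E => e.1.2 = j),
          (N.c e : ℝ) * b e * N.classWeight p R par e := by
        refine Finset.sum_congr rfl fun j _ => ?_
        rw [Finset.sum_mul]
        refine Finset.sum_congr rfl fun e he => ?_
        have he' := (Finset.mem_filter.1 he).2
        by_cases hmem : e ∈ N.classEdges p
        · simp [classWeight, hmem, hw, he']
        · simp [hsupp e hmem]
    _ = ∑ e, (N.c e : ℝ) * b e * N.classWeight p R par e :=
        Finset.sum_fiberwise _ _ _

theorem sum_classRate_mul_childSum_le {p : Fin K → NodeOrder V} (hp : ∀ k, N.SourceFirst (p k))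
    {R : Fin K → V → ℕ} {par : Fin K → V → V}
    (hpar : ∀ k, N.IsMinimizer (p k) (R k) (par k)) {β : Fin K → N.E → ℝ} (hβ : N.Feasible p β) :
    ∑ k, N.classRate (β k) * N.childSum (p k) (R k) (par k) N.r ≤
      ∑ e, (N.c e : ℝ) * (∑ k, β k) e * N.linkWeight p R par e := by
  calc ∑ k, N.classRate (β k) * N.childSum (p k) (R k) (par k) N.r
      ≤ ∑ k, ∑ e, (N.c e : ℝ) * β k e * N.linkWeight p R par e := by
        refine Finset.sum_le_sum fun k _ => (classRate_mul_childSum_le (hp k) (hpar k)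
          (hβ.1 k) (hβ.2.1 k)).trans (Finset.sum_le_sum fun e _ => ?_)
        exact mul_le_mul_of_nonneg_left
          (by exact_mod_cast classWeight_le_linkWeight p R par k e)
          (mul_nonneg (Nat.cast_nonneg _) (hβ.1 k e))
    _ = ∑ e, (N.c e : ℝ) * (∑ k, β k) e * N.linkWeight p R par e := by
        rw [Finset.sum_comm]
        refine Finset.sum_congr rfl fun e _ => ?_
        rw [Finset.sum_apply, Finset.mul_sum, Finset.sum_mul]

/-- The service, weighted by the differences of the deficits, is the weight of the activation: every
active link of positive weight serves a class in which it has that weight. -/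
theorem sum_service_mul {p : Fin K → NodeOrder V} {R : Fin K → V → ℕ} {par : Fin K → V → V}
    {s : N.E → Bool} {κ : N.E → Fin K}
    (hκ : ∀ e, s e = true → 0 < N.linkWeight p R par e →
      e ∈ N.classEdges (p (κ e)) ∧
      N.classWeight (p (κ e)) (R (κ e)) (par (κ e)) e = N.linkWeight p R par e) :
    ∑ k, ∑ j, (N.service (N.linkWeight p R par) s κ k j : ℝ) *
        ((N.minDeficit (p k) (R k) j : ℝ) - N.childSum (p k) (R k) (par k) j) =
      N.activationWeight (N.linkWeight p R par) s := by
  have e1 : ∀ k j, (N.service (N.linkWeight p R par) s κ k j : ℝ) *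
        ((N.minDeficit (p k) (R k) j : ℝ) - N.childSum (p k) (R k) (par k) j) =
      ∑ e, if e.1.2 = j then if κ e = k then
        (N.c e * (if s e then 1 else 0) * N.linkWeight p R par e : ℝ) else 0 else 0 := by
    intro k j
    rw [service, Nat.cast_sum, Finset.sum_mul, Finset.sum_filter]
    refine Finset.sum_congr rfl fun e _ => ?_
    by_cases h1 : e.1.2 = j
    · by_cases h2 : κ e = k
      · by_cases h3 : s e = true
        · by_cases h4 : 0 < N.linkWeight p R par e
          · have h5 := hκ e h3 h4
            subst h1 h2
            rw [if_pos ⟨rfl, h3, h4, rfl⟩, if_pos rfl, if_pos rfl, if_pos h3, mul_one]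
            congr 1
            have h6 := h5.2
            rw [classWeight, if_pos h5.1] at h6
            have h7 : N.minDeficit (p (κ e)) (R (κ e)) e.1.2 -
              N.childSum (p (κ e)) (R (κ e)) (par (κ e)) e.1.2 = N.linkWeight p R par e := by
              omega
            exact_mod_cast h7
          · have h5 : N.linkWeight p R par e = 0 := by omega
            simp [h5]
        · simp [h3]
      · simp [h2]
    · simp [h1]
  simp_rw [e1]
  rw [Finset.sum_congr rfl fun k _ => Finset.sum_comm, Finset.sum_comm]
  simp [activationWeight]

end WirelessNetwork

/-! ### The Lyapunov function and the trajectories -/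

namespace WirelessNetwork

variable {V : Type*} [Fintype V] [DecidableEq V] {N : WirelessNetwork V} {K : ℕ}

/-- The quadratic Lyapunov function: the sum of the squares of all minimum deficits. -/
noncomputable def lyapunov (N : WirelessNetwork V) (p : Fin K → NodeOrder V) (R : Fin K → V → ℕ) :
    ℝ :=
  ∑ k, ∑ j, (N.minDeficit (p k) (R k) j : ℝ) ^ 2

/-- The smallest value of `∑_{m ∈ K_r} X_m` among the classes whose DAG is connected, the value at
every class that may receive new packets (zero if there is no connected class). -/
noncomputable def admissionLevel (N : WirelessNetwork V) (p : Fin K → NodeOrder V)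
    (R : Fin K → V → ℕ) (par : Fin K → V → V) : ℝ :=
  ⨅ k : {k : Fin K // N.Usable (p k)}, (N.childSum (p k) (R k) (par k) N.r : ℝ)

theorem lyapunov_nonneg (p : Fin K → NodeOrder V) (R : Fin K → V → ℕ) : 0 ≤ N.lyapunov p R :=
  Finset.sum_nonneg fun _ _ => Finset.sum_nonneg fun _ _ => sq_nonneg _

theorem minDeficit_le_sqrt_lyapunov (p : Fin K → NodeOrder V) (R : Fin K → V → ℕ) (k : Fin K)
    (j : V) : (N.minDeficit (p k) (R k) j : ℝ) ≤ √(N.lyapunov p R) := by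
  refine Real.le_sqrt_of_sq_le ?_
  refine (Finset.single_le_sum (f := fun j => (N.minDeficit (p k) (R k) j : ℝ) ^ 2)
    (fun _ _ => sq_nonneg _) (Finset.mem_univ j)).trans ?_
  exact Finset.single_le_sum (f := fun k => ∑ j, (N.minDeficit (p k) (R k) j : ℝ) ^ 2)
    (fun _ _ => Finset.sum_nonneg fun _ _ => sq_nonneg _) (Finset.mem_univ k)

theorem admissionLevel_le {p : Fin K → NodeOrder V} (R : Fin K → V → ℕ) (par : Fin K → V → V)
    {k : Fin K} (hk : N.Usable (p k)) :
    N.admissionLevel p R par ≤ N.childSum (p k) (R k) (par k) N.r :=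
  ciInf_le (f := fun k : {k : Fin K // N.Usable (p k)} =>
    (N.childSum (p k) (R k) (par k) N.r : ℝ)) (Set.finite_range _).bddBelow ⟨k, hk⟩

theorem admissionLevel_nonneg {p : Fin K → NodeOrder V} {R : Fin K → V → ℕ}
    (hR : ∀ k, N.Ordered (p k) (R k)) (par : Fin K → V → V) : 0 ≤ N.admissionLevel p R par :=
  Real.iInf_nonneg fun k => by exact_mod_cast (hR k).childSum_nonneg _ _

theorem Admissible.childSum_eq {p : Fin K → NodeOrder V} {R : Fin K → V → ℕ}
    {par : Fin K → V → V} {l : Fin K} (h : N.Admissible p R par l)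
    (hu : ∃ m, N.Usable (p m)) :
    (N.childSum (p l) (R l) (par l) N.r : ℝ) = N.admissionLevel p R par := by
  obtain ⟨hl, hmin⟩ := h hu
  have : Nonempty {k : Fin K // N.Usable (p k)} := ⟨⟨l, hl⟩⟩
  refine le_antisymm (le_ciInf fun m => ?_) (admissionLevel_le R par hl)
  exact_mod_cast hmin m m.2

/-- The drift of the Lyapunov function in one slot, against a feasible family of total rate at least
`lam`: max-weight compares the service with the family, and the admission rule compares the
arrivals with it. -/
theorem Slot.lyapunov_le {p : Fin K → NodeOrder V} {R R' : Fin K → V → ℕ} {par : Fin K → V → V}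
    {A : ℕ} (h : N.Slot p R par A R') (hp : ∀ k, N.SourceFirst (p k))
    (hR : ∀ k, N.Ordered (p k) (R k)) (hu : ∃ k, N.Usable (p k)) {β : Fin K → N.E → ℝ}
    (hβ : N.Feasible p β) {lam : ℝ} (hlam : lam ≤ N.totalRate β) :
    N.lyapunov p R' ≤ N.lyapunov p R +
      2 * (K * Fintype.card V) * ((∑ e, N.c e : ℕ) + (A : ℝ)) ^ 2 +
      2 * (((A : ℝ) - lam) * N.admissionLevel p R par) := by
  obtain ⟨hpar, a, s, κ, ha, hadm, -, hs, hκ, hstep⟩ := h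
  set W := N.linkWeight p R par with hW
  set L := N.admissionLevel p R par with hL
  have hL0 : 0 ≤ L := admissionLevel_nonneg hR par
  have hk : ∀ k, ∑ j, (N.minDeficit (p k) (R' k) j : ℝ) ^ 2 ≤
      ∑ j, (N.minDeficit (p k) (R k) j : ℝ) ^ 2 +
        2 * Fintype.card V * ((∑ e, N.c e : ℕ) + (A : ℝ)) ^ 2 +
        2 * (a k * N.childSum (p k) (R k) (par k) N.r) -
        2 * ∑ j, (N.service W s κ k j : ℝ) *
          ((N.minDeficit (p k) (R k) j : ℝ) - N.childSum (p k) (R k) (par k) j) := by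
    intro k
    refine ClassStep.sum_sq_le (fun j => hstep k j) (hp k) (hR k) (hpar k) fun j => ?_
    have h1 : N.service W s κ k j ≤ ∑ e, N.c e :=
      Finset.sum_le_sum_of_subset (Finset.filter_subset _ _)
    have h2 : a k ≤ A := ha ▸ Finset.single_le_sum (fun _ _ => Nat.zero_le _) (Finset.mem_univ k)
    exact_mod_cast Nat.add_le_add h1 h2
  have hsum := Finset.sum_le_sum fun k (_ : k ∈ Finset.univ) => hk k
  rw [Finset.sum_sub_distrib, Finset.sum_add_distrib, Finset.sum_add_distrib, Finset.sum_const,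
    Finset.card_univ, Fintype.card_fin, nsmul_eq_mul, ← Finset.mul_sum, ← Finset.mul_sum,
    sum_service_mul hκ] at hsum
  have harr : ∑ k, (a k : ℝ) * N.childSum (p k) (R k) (par k) N.r = A * L := by
    rw [← ha, Nat.cast_sum, Finset.sum_mul]
    refine Finset.sum_congr rfl fun k _ => ?_
    by_cases hak : a k = 0
    · simp [hak]
    · rw [(hadm k hak).childSum_eq hu]
  have hserv : lam * L ≤ N.activationWeight W s :=
    calc lam * L ≤ N.totalRate β * L := mul_le_mul_of_nonneg_right hlam hL0
      _ = ∑ k, N.classRate (β k) * L := by rw [totalRate_eq_sum_classRate, Finset.sum_mul]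
      _ ≤ ∑ k, N.classRate (β k) * N.childSum (p k) (R k) (par k) N.r := by
          refine Finset.sum_le_sum fun k _ => ?_
          by_cases hku : N.Usable (p k)
          · exact mul_le_mul_of_nonneg_left (admissionLevel_le R par hku)
              (classRate_nonneg (hβ.1 k))
          · simp [classRate_eq_zero (hβ.1 k) (hβ.2.1 k) hku]
      _ ≤ _ := sum_classRate_mul_childSum_le hp hpar hβ
      _ ≤ _ := sum_le_activationWeight hs hβ.2.2
  rw [harr] at hsum
  unfold lyapunov
  linarith

/-- A positive rate needs a class whose DAG is connected. -/
theorem exists_usable_of_totalRate_pos {p : Fin K → NodeOrder V} {β : Fin K → N.E → ℝ}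
    (hβ : N.Feasible p β) (h : 0 < N.totalRate β) : ∃ k, N.Usable (p k) := by
  by_contra! hu
  rw [totalRate_eq_sum_classRate,
    Finset.sum_eq_zero fun k _ => classRate_eq_zero (hβ.1 k) (hβ.2.1 k) (hu k)] at h
  exact h.false

section Trajectory

/-- A trajectory of the algorithm for fixed permutations and arrivals, from empty counters. -/
structure IsTrajectory (N : WirelessNetwork V) (p : Fin K → NodeOrder V)
    (R : ℕ → Fin K → V → ℕ) (par : ℕ → Fin K → V → V) (A : ℕ → ℕ) : Prop where
  sourceFirst : ∀ k, N.SourceFirst (p k)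
  init : ∀ k v, R 0 k v = 0
  slot : ∀ t, N.Slot p (R t) (par t) (A t) (R (t + 1))

variable {p : Fin K → NodeOrder V} {R : ℕ → Fin K → V → ℕ} {par : ℕ → Fin K → V → V}
  {A : ℕ → ℕ}

theorem IsTrajectory.classStep (h : N.IsTrajectory p R par A) (t : ℕ) (k : Fin K) :
    ∃ a M, N.ClassStep (p k) (R t k) a M (R (t + 1) k) := by
  obtain ⟨-, a, s, κ, -, -, -, -, -, hstep⟩ := h.slot t
  exact ⟨a k, _, fun j => hstep k j⟩

theorem IsTrajectory.monotone (h : N.IsTrajectory p R par A) (k : Fin K) (j : V) :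
    Monotone fun t => R t k j :=
  monotone_nat_of_le_succ fun t => by
    obtain ⟨a, M, hs⟩ := h.classStep t k
    exact hs.le j

theorem IsTrajectory.ordered (h : N.IsTrajectory p R par A) (t : ℕ) (k : Fin K) :
    N.Ordered (p k) (R t k) := by
  induction t with
  | zero => intro j i _; simp [h.init]
  | succ t ih =>
    obtain ⟨a, M, hs⟩ := h.classStep t k
    exact hs.ordered (h.sourceFirst k) ih

theorem IsTrajectory.le_source (h : N.IsTrajectory p R par A) (t : ℕ) (k : Fin K) (j : V) :
    R t k j ≤ R t k N.r := by
  induction t generalizing j with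
  | zero => simp [h.init]
  | succ t ih =>
    obtain ⟨a, M, hs⟩ := h.classStep t k
    exact hs.le_source (h.sourceFirst k) (h.ordered t k) ih j

theorem IsTrajectory.sum_source (h : N.IsTrajectory p R par A) (t : ℕ) :
    ∑ k, R t k N.r = ∑ s ∈ Finset.range t, A s := by
  induction t with
  | zero => simp [h.init]
  | succ t ih =>
    obtain ⟨-, a, s, κ, ha, -, -, -, -, hstep⟩ := h.slot t
    rw [Finset.sum_range_succ, ← ih, ← ha, ← Finset.sum_add_distrib]
    exact Finset.sum_congr rfl fun k _ => by rw [hstep, if_pos rfl]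

theorem IsTrajectory.source_eq_zero (h : N.IsTrajectory p R par A) (hu : ∃ k, N.Usable (p k))
    {k : Fin K} (hk : ¬ N.Usable (p k)) (t : ℕ) : R t k N.r = 0 := by
  induction t with
  | zero => exact h.init _ _
  | succ t ih =>
    obtain ⟨-, a, s, κ, -, hadm, -, -, -, hstep⟩ := h.slot t
    have ha : a k = 0 := by
      by_contra hak
      exact hk (hadm k hak hu).1
    rw [hstep, if_pos rfl, ih, ha]

theorem IsTrajectory.minDeficit_le (h : N.IsTrajectory p R par A) (t : ℕ) (k : Fin K) (j : V) :
    N.minDeficit (p k) (R t k) j ≤ (∑ s ∈ Finset.range t, A s : ℕ) := by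
  by_cases hn : (N.inNbrs (p k) j).Nonempty
  · obtain ⟨i, hi⟩ := hn
    have h1 := WirelessNetwork.minDeficit_le (R := R t k) hi
    have h2 := h.le_source t k i
    have h3 : R t k N.r ≤ ∑ k, R t k N.r :=
      Finset.single_le_sum (f := fun k => R t k N.r) (fun _ _ => Nat.zero_le _)
        (Finset.mem_univ k)
    rw [h.sum_source] at h3
    unfold deficit at h1
    omega
  · rw [minDeficit_eq_zero hn]
    positivity

theorem IsTrajectory.lyapunov_le (h : N.IsTrajectory p R par A) (t : ℕ) :
    N.lyapunov p (R t) ≤ K * Fintype.card V * (∑ s ∈ Finset.range t, (A s : ℝ)) ^ 2 := by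
  have h1 : ∀ k j, (N.minDeficit (p k) (R t k) j : ℝ) ^ 2 ≤
      (∑ s ∈ Finset.range t, (A s : ℝ)) ^ 2 := fun k j => by
    refine pow_le_pow_left₀ (by exact_mod_cast (h.ordered t k).minDeficit_nonneg j) ?_ 2
    exact_mod_cast h.minDeficit_le t k j
  refine (Finset.sum_le_sum fun k _ => Finset.sum_le_sum fun j _ => h1 k j).trans (le_of_eq ?_)
  simp [mul_assoc]

theorem IsTrajectory.admissionLevel_le (h : N.IsTrajectory p R par A) (t : ℕ) :
    N.admissionLevel p (R t) (par t) ≤ Fintype.card V * ∑ s ∈ Finset.range t, (A s : ℝ) := by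
  by_cases hu : ∃ k, N.Usable (p k)
  · obtain ⟨k, hk⟩ := hu
    refine (WirelessNetwork.admissionLevel_le _ _ hk).trans ?_
    rw [childSum, Int.cast_sum, ← nsmul_eq_mul, ← Finset.card_univ, ← Finset.sum_const]
    refine (Finset.sum_le_sum fun m _ => ?_).trans (Finset.sum_le_sum_of_subset_of_nonneg
      (Finset.subset_univ _) fun _ _ _ => Finset.sum_nonneg fun _ _ => Nat.cast_nonneg _)
    exact_mod_cast h.minDeficit_le t k m
  · have : IsEmpty {k : Fin K // N.Usable (p k)} := ⟨fun k => hu ⟨k, k.2⟩⟩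
    rw [admissionLevel, Real.iInf_of_isEmpty]
    positivity

/-- No node is ahead of the source. -/
theorem IsTrajectory.sum_le (h : N.IsTrajectory p R par A) (t : ℕ) (j : V) :
    ((∑ k, R t k j : ℕ) : ℝ) ≤ ∑ s ∈ Finset.range t, (A s : ℝ) := by
  have h1 := Finset.sum_le_sum fun k (_ : k ∈ Finset.univ) => h.le_source t k j
  rw [h.sum_source] at h1
  exact_mod_cast h1

/-- Every node lags behind the source by at most a multiple of the square root of the Lyapunov
function. -/
theorem IsTrajectory.le_sum (h : N.IsTrajectory p R par A) (hu : ∃ k, N.Usable (p k)) (t : ℕ)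
    (j : V) :
    ∑ s ∈ Finset.range t, (A s : ℝ) - K * Fintype.card V * √(N.lyapunov p (R t)) ≤
      ((∑ k, R t k j : ℕ) : ℝ) := by
  have h1 : ∀ k, (R t k N.r : ℝ) - R t k j ≤ Fintype.card V * √(N.lyapunov p (R t)) := by
    intro k
    by_cases hk : N.Usable (p k)
    · exact hk.deficit_source_le ((h.slot t).1 k) (minDeficit_le_sqrt_lyapunov p (R t) k)
        (Real.sqrt_nonneg _) j
    · rw [h.source_eq_zero hu hk, Nat.cast_zero, zero_sub]
      exact (neg_nonpos.2 (Nat.cast_nonneg _)).trans (by positivity)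
  have h2 := Finset.sum_le_sum fun k (_ : k ∈ Finset.univ) => h1 k
  have h3 : ((∑ k, R t k N.r : ℕ) : ℝ) = ∑ s ∈ Finset.range t, (A s : ℝ) := by
    rw [h.sum_source]; push_cast; rfl
  rw [Finset.sum_sub_distrib, Finset.sum_const, Finset.card_univ, Fintype.card_fin,
    nsmul_eq_mul] at h2
  push_cast at h3 ⊢
  linarith

/-- On a trajectory where the Lyapunov function is negligible along the squares, every node receives
packets at the arrival rate. -/
theorem IsTrajectory.tendsto_div (h : N.IsTrajectory p R par A) (hu : ∃ k, N.Usable (p k))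
    {lam : ℝ} (hA : Tendsto (fun n : ℕ => (∑ s ∈ Finset.range n, (A s : ℝ)) / n) atTop (nhds lam))
    (hL : Tendsto (fun n : ℕ => N.lyapunov p (R (n ^ 2)) / (n : ℝ) ^ 4) atTop (nhds 0)) (j : V) :
    Tendsto (fun T : ℕ => ((∑ k, R T k j : ℕ) : ℝ) / T) atTop (nhds lam) := by
  refine tendsto_div_of_monotone_of_exists_subseq_tendsto_div _ _ ?_ fun a ha =>
    ⟨fun n => n ^ 2, ?_, tendsto_pow_atTop two_ne_zero, ?_⟩
  · intro s t hst
    exact Nat.cast_le.2 (Finset.sum_le_sum fun k _ => h.monotone k j hst)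
  · have h1 : Tendsto (fun n : ℕ => (1 + 1 / (n : ℝ)) ^ 2) atTop (nhds 1) := by
      simpa using (tendsto_one_div_atTop_nhds_zero_nat (𝕜 := ℝ)).const_add 1 |>.pow 2
    filter_upwards [h1.eventually (ge_mem_nhds ha), eventually_gt_atTop 0] with n hn hn0
    have hn0' : (0 : ℝ) < n := by exact_mod_cast hn0
    have h2 : ((n : ℝ) + 1) ^ 2 = (1 + 1 / (n : ℝ)) ^ 2 * n ^ 2 := by
      field_simp
    push_cast
    rw [h2]
    exact mul_le_mul_of_nonneg_right hn (by positivity)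
  · have hA' := hA.comp (tendsto_pow_atTop (α := ℕ) two_ne_zero)
    have hlow : Tendsto (fun n : ℕ => (∑ s ∈ Finset.range (n ^ 2), (A s : ℝ)) / (n ^ 2 : ℕ) -
        K * Fintype.card V * √(N.lyapunov p (R (n ^ 2)) / (n : ℝ) ^ 4)) atTop (nhds lam) := by
      simpa using hA'.sub ((hL.sqrt).const_mul ((K : ℝ) * Fintype.card V))
    refine tendsto_of_tendsto_of_tendsto_of_le_of_le hlow hA' (fun n => ?_) fun n => ?_
    · have h1 : √(N.lyapunov p (R (n ^ 2)) / (n : ℝ) ^ 4) =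
          √(N.lyapunov p (R (n ^ 2))) / (n ^ 2 : ℕ) := by
        rw [Real.sqrt_div' _ (by positivity)]
        congr 1
        rw [show (n : ℝ) ^ 4 = (n ^ 2) ^ 2 by ring, Real.sqrt_sq (by positivity)]
        push_cast; rfl
      dsimp only
      rw [h1, ← mul_div_assoc, ← sub_div]
      exact div_le_div_of_nonneg_right (h.le_sum hu _ j) (Nat.cast_nonneg _)
    · exact div_le_div_of_nonneg_right (h.sum_le _ j) (Nat.cast_nonneg _)

end Trajectory

end WirelessNetwork

/-! ### Arrivals and the almost sure behaviour -/

section Arrivals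

variable {Ω : Type*} [mΩ : MeasurableSpace Ω] {μ : Measure Ω}
  {ℱ : Filtration ℕ mΩ} {A : ℕ → Ω → ℕ} {lam : ℝ}

theorem IsArrivalProcess.memLp_two (h : IsArrivalProcess μ ℱ A lam) (t : ℕ) :
    MemLp (fun ω => (A t ω : ℝ)) 2 μ :=
  ((h.identDistrib t).comp
    (measurable_from_top (f := fun n : ℕ => (n : ℝ)))).symm.memLp_snd h.memLp

theorem IsArrivalProcess.integral_eq (h : IsArrivalProcess μ ℱ A lam) (t : ℕ) :
    ∫ ω, (A t ω : ℝ) ∂μ = lam :=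
  (((h.identDistrib t).comp (measurable_from_top (f := fun n : ℕ => (n : ℝ)))).integral_eq).trans
    h.mean

theorem IsArrivalProcess.mean_nonneg (h : IsArrivalProcess μ ℱ A lam) : 0 ≤ lam :=
  h.mean ▸ integral_nonneg fun _ => Nat.cast_nonneg _

theorem IsArrivalProcess.integral_add_sq_eq (h : IsArrivalProcess μ ℱ A lam) (C : ℝ) (t : ℕ) :
    ∫ ω, (C + (A t ω : ℝ)) ^ 2 ∂μ = ∫ ω, (C + (A 0 ω : ℝ)) ^ 2 ∂μ :=
  ((h.identDistrib t).comp
    (measurable_from_top (f := fun n : ℕ => (C + (n : ℝ)) ^ 2))).integral_eq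

theorem IsArrivalProcess.integrable_add_sq [IsProbabilityMeasure μ]
    (h : IsArrivalProcess μ ℱ A lam) (C : ℝ) (t : ℕ) :
    Integrable (fun ω => (C + (A t ω : ℝ)) ^ 2) μ :=
  ((memLp_const C).add (h.memLp_two t)).integrable_sq

theorem IsArrivalProcess.memLp_two_sum (h : IsArrivalProcess μ ℱ A lam) (t : ℕ) :
    MemLp (fun ω => ∑ s ∈ Finset.range t, (A s ω : ℝ)) 2 μ :=
  memLp_finsetSum _ fun s _ => h.memLp_two s

/-- The strong law of large numbers for the arrivals. -/
theorem IsArrivalProcess.ae_tendsto_sum_div [IsProbabilityMeasure μ]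
    (h : IsArrivalProcess μ ℱ A lam) :
    ∀ᵐ ω ∂μ, Tendsto (fun n : ℕ => (∑ s ∈ Finset.range n, (A s ω : ℝ)) / n) atTop (nhds lam) := by
  have hcast : Measurable fun n : ℕ => (n : ℝ) := measurable_from_top
  have h1 := strong_law_ae_real (μ := μ) (fun t ω => (A t ω : ℝ))
    ((h.memLp_two 0).integrable one_le_two)
    (fun i j hij => (h.indep.indepFun hij).comp hcast hcast)
    (fun t => (h.identDistrib t).comp hcast)
  rwa [h.mean] at h1

/-- The deviation of the arrivals from their mean is orthogonal to every variable that the past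
determines. -/
theorem IsArrivalProcess.integral_sub_mul [IsProbabilityMeasure μ]
    (h : IsArrivalProcess μ ℱ A lam) {t : ℕ} {g : Ω → ℝ}
    (hg : Measurable[ℱ t] g) (hint : Integrable g μ) :
    Integrable (fun ω => ((A t ω : ℝ) - lam) * g ω) μ ∧
      ∫ ω, ((A t ω : ℝ) - lam) * g ω ∂μ = 0 := by
  have hsub : Measurable fun n : ℕ => (n : ℝ) - lam := measurable_from_top
  have hA : Integrable (fun ω => (A t ω : ℝ) - lam) μ :=
    ((h.memLp_two t).integrable one_le_two).sub (integrable_const lam)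
  have hind : IndepFun (fun ω => (A t ω : ℝ) - lam) g μ := by
    rw [IndepFun_iff_Indep]
    refine indep_of_indep_of_le_left (indep_of_indep_of_le_right (h.indep_past t) hg.comap_le) ?_
    exact (hsub.comp (comap_measurable (A t))).comap_le
  refine ⟨hind.integrable_mul hA hint, ?_⟩
  rw [hind.integral_fun_mul_eq_mul_integral hA.aestronglyMeasurable hint.aestronglyMeasurable,
    integral_sub ((h.memLp_two t).integrable one_le_two) (integrable_const lam), h.integral_eq t]
  simp

/-- A process whose mean grows at most linearly is negligible against the fourth power along the
squares: the means of `Y (n²) / n⁴` are summable. -/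
theorem ae_tendsto_sq_div_of_integral_le {Y : ℕ → Ω → ℝ} (hY : ∀ t, Integrable (Y t) μ)
    (hY0 : ∀ t ω, 0 ≤ Y t ω) {c : ℝ} (hc : ∀ t : ℕ, ∫ ω, Y t ω ∂μ ≤ c * t) :
    ∀ᵐ ω ∂μ, Tendsto (fun n : ℕ => Y (n ^ 2) ω / (n : ℝ) ^ 4) atTop (nhds 0) := by
  have hint : ∀ n : ℕ, Integrable (fun ω => Y (n ^ 2) ω / (n : ℝ) ^ 4) μ := fun n =>
    (hY _).div_const _
  have hnn : ∀ n : ℕ, ∀ ω, 0 ≤ Y (n ^ 2) ω / (n : ℝ) ^ 4 := fun n ω =>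
    div_nonneg (hY0 _ _) (by positivity)
  have hle : ∀ n : ℕ, ∫ ω, Y (n ^ 2) ω / (n : ℝ) ^ 4 ∂μ ≤ c * (1 / (n : ℝ) ^ 2) := fun n => by
    rw [integral_div]
    rcases Nat.eq_zero_or_pos n with rfl | hn
    · simp
    · have hn' : (0 : ℝ) < n := by exact_mod_cast hn
      refine (div_le_div_of_nonneg_right (hc _) (by positivity)).trans (le_of_eq ?_)
      push_cast
      field_simp
  have hsum : Summable fun n : ℕ => ∫ ω, Y (n ^ 2) ω / (n : ℝ) ^ 4 ∂μ :=
    Summable.of_nonneg_of_le (fun n => integral_nonneg (hnn n)) hle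
      ((Real.summable_one_div_nat_pow.2 one_lt_two).mul_left c)
  have hlin : ∫⁻ ω, ∑' n : ℕ, ENNReal.ofReal (Y (n ^ 2) ω / (n : ℝ) ^ 4) ∂μ ≠ ⊤ := by
    rw [lintegral_tsum fun n => (hint n).aemeasurable.ennreal_ofReal]
    simp_rw [← ofReal_integral_eq_lintegral_ofReal (hint _) (ae_of_all _ (hnn _))]
    exact hsum.tsum_ofReal_ne_top
  filter_upwards [ae_lt_top' (AEMeasurable.tsum fun n =>
    (hint n).aemeasurable.ennreal_ofReal) hlin] with ω hω
  have h1 := ENNReal.tendsto_atTop_zero_of_tsum_ne_top hω.ne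
  have h2 := (ENNReal.tendsto_toReal ENNReal.zero_ne_top).comp h1
  simpa [Function.comp_def, ENNReal.toReal_ofReal (hnn _ ω)] using h2

end Arrivals

section Run

variable {V : Type*} [Fintype V] [DecidableEq V] {N : WirelessNetwork V} {K : ℕ}
  {Ω : Type*} [mΩ : MeasurableSpace Ω] {ℱ : Filtration ℕ mΩ} {A : ℕ → Ω → ℕ}
  {σ : Ω → Fin K → NodeOrder V} {R : Ω → ℕ → Fin K → V → ℕ} {par : Ω → ℕ → Fin K → V → V}

theorem IsMulticlassRun.isTrajectory (h : IsMulticlassRun N ℱ A σ R par) (ω : Ω) :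
    N.IsTrajectory (σ ω) (R ω) (par ω) (fun t => A t ω) :=
  ⟨h.sourceFirst ω, h.init ω, h.slot ω⟩

/-- Every function of the state (permutations, counters, minimizers) is known before the arrivals
of the slot, as the state takes countably many values. -/
theorem IsMulticlassRun.measurable_state (h : IsMulticlassRun N ℱ A σ R par) (t : ℕ)
    (f : (Fin K → NodeOrder V) → (Fin K → V → ℕ) → (Fin K → V → V) → ℝ) :
    Measurable[ℱ t] fun ω => f (σ ω) (R ω t) (par ω t) := by
  let X := (Fin K → NodeOrder V) × (Fin K → V → ℕ) × (Fin K → V → V)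
  let _ : MeasurableSpace X := ⊤
  have hg : Measurable[ℱ t] fun ω => ((σ ω, R ω t, par ω t) : X) := by
    refine @measurable_to_countable' X Ω _ _ (ℱ t) _ fun x => ?_
    have e1 : (fun ω => ((σ ω, R ω t, par ω t) : X)) ⁻¹' {x} =
        (⋂ k, ⋂ v, {ω | σ ω k v = x.1 k v}) ∩ ((⋂ k, ⋂ v, {ω | R ω t k v = x.2.1 k v}) ∩
          ⋂ k, ⋂ v, {ω | par ω t k v = x.2.2 k v}) := by
      ext ω
      simp [Prod.ext_iff, funext_iff, DFunLike.ext_iff]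
    rw [e1]
    refine MeasurableSet.inter (.iInter fun k => .iInter fun v => ?_)
      (.inter (.iInter fun k => .iInter fun v => ?_) (.iInter fun k => .iInter fun v => ?_))
    · exact ((h.order_measurable k v).mono (ℱ.mono (Nat.zero_le t)) le_rfl)
        (measurableSet_singleton (x.1 k v))
    · exact h.counter_measurable t k v (measurableSet_singleton (x.2.1 k v))
    · exact h.par_measurable t k v _
  exact (measurable_from_top (f := fun x : X => f x.1 x.2.1 x.2.2)).comp hg

open Classical in
/-- At arrival rates up to the rate of the classes, the Lyapunov function is negligible along the
squares. -/
theorem IsMulticlassRun.ae_tendsto_lyapunov [Nontrivial V] {μ : Measure Ω}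
    [IsProbabilityMeasure μ] {lam : ℝ} (h : IsMulticlassRun N ℱ A σ R par)
    (hA : IsArrivalProcess μ ℱ A lam) (hlam : 0 < lam) :
    ∀ᵐ ω ∂μ, lam ≤ N.multiclassRate (σ ω) →
      Tendsto (fun n : ℕ => N.lyapunov (σ ω) (R ω (n ^ 2)) / (n : ℝ) ^ 4) atTop (nhds 0) := by
  -- The event that the rate is large enough is decided by the permutations; outside of it the
  -- Lyapunov function and the admission level are replaced by zero.
  set Y : ℕ → Ω → ℝ := fun t ω =>
    if lam ≤ N.multiclassRate (σ ω) then N.lyapunov (σ ω) (R ω t) else 0 with hY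
  set m : ℕ → Ω → ℝ := fun t ω =>
    if lam ≤ N.multiclassRate (σ ω) then N.admissionLevel (σ ω) (R ω t) (par ω t) else 0 with hm
  set C : ℝ := ((∑ e, N.c e : ℕ) : ℝ)
  have hYmeas : ∀ t, Measurable (Y t) := fun t =>
    (h.measurable_state t fun p R _ =>
      if lam ≤ N.multiclassRate p then N.lyapunov p R else 0).mono (ℱ.le t) le_rfl
  have hmmeas : ∀ t, Measurable[ℱ t] (m t) := fun t =>
    h.measurable_state t fun p R par =>
      if lam ≤ N.multiclassRate p then N.admissionLevel p R par else 0
  have hY0 : ∀ t ω, 0 ≤ Y t ω := fun t ω => by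
    simp only [hY]
    split_ifs
    exacts [WirelessNetwork.lyapunov_nonneg _ _, le_rfl]
  have hm0 : ∀ t ω, 0 ≤ m t ω := fun t ω => by
    simp only [hm]
    split_ifs
    exacts [WirelessNetwork.admissionLevel_nonneg ((h.isTrajectory ω).ordered t) _, le_rfl]
  have hYint : ∀ t, Integrable (Y t) μ := fun t => by
    refine ((hA.memLp_two_sum t).integrable_sq.const_mul ((K : ℝ) * Fintype.card V)).mono'
      (hYmeas t).aestronglyMeasurable (ae_of_all _ fun ω => ?_)
    rw [Real.norm_of_nonneg (hY0 t ω)]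
    simp only [hY]
    split_ifs
    exacts [(h.isTrajectory ω).lyapunov_le t, by positivity]
  have hmint : ∀ t, Integrable (m t) μ := fun t => by
    refine (((hA.memLp_two_sum t).integrable one_le_two).const_mul (Fintype.card V : ℝ)).mono'
      ((hmmeas t).mono (ℱ.le t) le_rfl).aestronglyMeasurable (ae_of_all _ fun ω => ?_)
    rw [Real.norm_of_nonneg (hm0 t ω)]
    simp only [hm]
    split_ifs
    exacts [(h.isTrajectory ω).admissionLevel_le t, by positivity]
  have hstep : ∀ t ω, Y (t + 1) ω ≤ Y t ω +
      2 * (K * Fintype.card V) * (C + (A t ω : ℝ)) ^ 2 + 2 * (((A t ω : ℝ) - lam) * m t ω) := by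
    intro t ω
    by_cases hω : lam ≤ N.multiclassRate (σ ω)
    · obtain ⟨β, hβ, hrate⟩ :=
        WirelessNetwork.exists_feasible_of_multiclassRate_pos (hlam.trans_le hω)
      simp only [hY, hm, if_pos hω]
      exact (h.slot ω t).lyapunov_le (h.sourceFirst ω) ((h.isTrajectory ω).ordered t)
        (WirelessNetwork.exists_usable_of_totalRate_pos hβ (hrate ▸ hlam.trans_le hω)) hβ
        (hrate ▸ hω)
    · simp only [hY, hm, if_neg hω]
      simp only [mul_zero, add_zero, zero_add]
      positivity
  have hmean : ∀ t : ℕ, ∫ ω, Y t ω ∂μ ≤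
      (2 * (K * Fintype.card V) * ∫ ω, (C + (A 0 ω : ℝ)) ^ 2 ∂μ) * t := by
    intro t
    induction t with
    | zero =>
      have : ∀ ω, Y 0 ω = 0 := fun ω => by
        refine le_antisymm ?_ (hY0 0 ω)
        simp only [hY]
        split_ifs
        · simpa using (h.isTrajectory ω).lyapunov_le 0
        · exact le_rfl
      simp [this]
    | succ t ih =>
      obtain ⟨hi, hz⟩ := hA.integral_sub_mul (hmmeas t) (hmint t)
      have hs := (hA.integrable_add_sq C t).const_mul (2 * ((K : ℝ) * Fintype.card V))
      have hadd : Integrable (fun ω => Y t ω +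
          2 * (K * Fintype.card V) * (C + (A t ω : ℝ)) ^ 2) μ := (hYint t).add hs
      have h1 := integral_mono (hYint (t + 1)) (hadd.add (hi.const_mul 2)) (hstep t)
      rw [integral_add' hadd (hi.const_mul 2), integral_const_mul, hz,
        integral_add (hYint t) hs, integral_const_mul, hA.integral_add_sq_eq] at h1
      push_cast
      linarith
  filter_upwards [ae_tendsto_sq_div_of_integral_le hYint hY0 hmean] with ω hω hrate
  simpa only [hY, if_pos hrate] using hω

end Run

theorem broadcastRate_eq_of_tendsto {V : Type*} [Nonempty V] {K : ℕ} {R : ℕ → Fin K → V → ℕ}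
    {lam : ℝ}
    (h : ∀ i, Tendsto (fun T : ℕ => ((∑ k, R T k i : ℕ) : ℝ) / T) atTop (nhds lam)) :
    broadcastRate R = (lam : EReal) := by
  have h1 : ∀ i, liminf (fun T : ℕ =>
      (((∑ k, R T k i : ℕ) : ℝ) / (T : ℝ) : ℝ).toEReal) atTop = (lam : EReal) := fun i =>
    ((continuous_coe_real_ereal.tendsto lam).comp (h i)).liminf_eq
  rw [broadcastRate]
  simp_rw [h1]
  exact iInf_const

theorem theorem4 {V : Type*} [Fintype V] [DecidableEq V] [Nontrivial V]
    (N : WirelessNetwork V) (K : ℕ) (hK : 1 ≤ K) :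
    -- the maximum that defines `λ^K` is attained
    (∀ p : Fin K → NodeOrder V, (∀ k, N.SourceFirst (p k)) → (N.rateValues p).Nonempty →
      IsGreatest (N.rateValues p) (N.multiclassRate p)) ∧
    -- the algorithm broadcasts at every arrival rate up to `λ^K`
    (∀ {Ω : Type*} [mΩ : MeasurableSpace Ω] (μ : Measure Ω) [IsProbabilityMeasure μ]
      (ℱ : Filtration ℕ mΩ) (A : ℕ → Ω → ℕ) (lam : ℝ) (σ : Ω → Fin K → NodeOrder V)
      (R : Ω → ℕ → Fin K → V → ℕ) (par : Ω → ℕ → Fin K → V → V),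
      IsArrivalProcess μ ℱ A lam → IsMulticlassRun N ℱ A σ R par →
      ∀ᵐ ω ∂μ, lam ≤ N.multiclassRate (σ ω) → broadcastRate (R ω) = (lam : EReal)) := by
  refine ⟨fun p _ hne => WirelessNetwork.isGreatest_multiclassRate hne, ?_⟩
  intro Ω mΩ μ _ ℱ A lam σ R par hA hrun
  rcases hA.mean_nonneg.eq_or_lt with h0 | hpos
  · -- At mean zero only the upper bound is needed: no node gets ahead of the source, whose
    -- counters grow at rate zero.
    filter_upwards [hA.ae_tendsto_sum_div] with ω hω _
    rw [← h0] at hω ⊢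
    refine broadcastRate_eq_of_tendsto fun i => squeeze_zero (fun T => by positivity)
      (fun T => ?_) hω
    exact div_le_div_of_nonneg_right ((hrun.isTrajectory ω).sum_le T i) (Nat.cast_nonneg T)
  · filter_upwards [hA.ae_tendsto_sum_div, hrun.ae_tendsto_lyapunov hA hpos] with ω hω hL hrate
    obtain ⟨β, hβ, hβrate⟩ :=
      WirelessNetwork.exists_feasible_of_multiclassRate_pos (hpos.trans_le hrate)
    have hu := WirelessNetwork.exists_usable_of_totalRate_pos hβ (hβrate ▸ hpos.trans_le hrate)
    exact broadcastRate_eq_of_tendsto fun i =>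
      (hrun.isTrajectory ω).tendsto_div hu hω (hL hrate) i
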